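/- Let $k\ge 3$ and let $P_k$ be the path graph with vertices $1,\dots,k$ and edges $\{i,i+1\}$, $1\le i\le k-1$. Choose an arbitrary orientation of its edges. Every oriented edge $e=(x,y)$ defines a bijection of the set of finite words over the alphabet $\{1,\dots,k\}$, which fixes the empty word and satisfies, for every word $w$, $$e(xw)=y\,e(w),\qquad e(yw)=x\,w,\qquad e(zw)=z\,w\ \text{ for every letter } z\ne x,y.$$ These bijections generate the graph automaton group of $P_k$, which acts on the set $\{1,\dots,k\}^n$ of words of length $n$ for each $n$. For $n\ge 1$ let $\Gamma_n^{P_k}$ be the $n$-th Schreier graph of this group, regarded as an undirected graph: its vertex set is $\{1,\dots,k\}^n$, and two words $u,v$ are joined by an edge when $s(u)=v$ for some generator $s=e$ or inverse $s=e^{-1}$ of a generator. Then, for every $n\ge1$, the diameter (the maximum of the geodesic distances between two vertices) of $\Gamma_n^{P_k}$ is $$\operatorname{diam}(\Gamma_n^{P_k})=2^{n+1}+(k-1)(2n-1)-4n.$$ -/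

import Mathlib

namespace GraphAutomaton

/-- A (Mealy) automaton with states `S` and alphabet `X`. -/
structure Automaton (S X : Type*) where
  /-- the restriction (transition) map -/
  restr : S → X → S
  /-- the output map -/
  out : S → X → X

namespace Automaton

variable {S X : Type*}

/-- Every state permutes the alphabet. -/
def IsInvertible (A : Automaton S X) : Prop :=
  ∀ s, Function.Bijective (A.out s)

/-- The output map extended to finite words: `s(x w) = s(x) (s|ₓ)(w)`. -/
def wordOut (A : Automaton S X) : S → List X → List X
  | _, [] => []
  | s, x :: w => A.out s x :: A.wordOut (A.restr s x) w

theorem length_wordOut (A : Automaton S X) (s : S) (w : List X) :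
    (A.wordOut s w).length = w.length := by
  induction w generalizing s with
  | nil => rfl
  | cons x w ih => simp [wordOut, ih]

theorem wordOut_injective (A : Automaton S X) (hA : A.IsInvertible) (s : S) :
    Function.Injective (A.wordOut s) := by
  intro u
  induction u generalizing s with
  | nil =>
    intro v h
    cases v with
    | nil => rfl
    | cons y v => simp [wordOut] at h
  | cons x u ih =>
    intro v h
    cases v with
    | nil => simp [wordOut] at h
    | cons y v =>
      simp only [wordOut, List.cons.injEq] at h
      obtain rfl := (hA s).1 h.1
      rw [ih _ h.2]

theorem wordOut_surjective (A : Automaton S X) (hA : A.IsInvertible) (s : S) :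
    Function.Surjective (A.wordOut s) := by
  intro v
  induction v generalizing s with
  | nil => exact ⟨[], rfl⟩
  | cons y v ih =>
    obtain ⟨x, rfl⟩ := (hA s).2 y
    obtain ⟨u, rfl⟩ := ih (A.restr s x)
    exact ⟨x :: u, rfl⟩

/-- The bijection of the set of finite words defined by a state of an invertible automaton. -/
noncomputable def statePerm (A : Automaton S X) (hA : A.IsInvertible) (s : S) :
    Equiv.Perm (List X) :=
  Equiv.ofBijective (A.wordOut s) ⟨A.wordOut_injective hA s, A.wordOut_surjective hA s⟩

/-- The automaton group: the group of bijections of the set of finite words generated by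
the bijections defined by the states. -/
def group (A : Automaton S X) (hA : A.IsInvertible) : Subgroup (Equiv.Perm (List X)) :=
  Subgroup.closure (Set.range (A.statePerm hA))

/-- The generator of the automaton group given by a state. -/
noncomputable def gen (A : Automaton S X) (hA : A.IsInvertible) (s : S) : A.group hA :=
  ⟨A.statePerm hA s, Subgroup.subset_closure ⟨s, rfl⟩⟩

theorem length_group_apply (A : Automaton S X) (hA : A.IsInvertible) (g : A.group hA)
    (w : List X) : (g.1 w).length = w.length := by
  have key : ∀ f ∈ Subgroup.closure (Set.range (A.statePerm hA)),
      ∀ w : List X, (f w).length = w.length := by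
    intro f hf
    induction hf using Subgroup.closure_induction with
    | mem f hf =>
      obtain ⟨s, rfl⟩ := hf
      exact A.length_wordOut s
    | one => intro w; rfl
    | mul f g _ _ hf hg => intro w; rw [Equiv.Perm.mul_apply, hf, hg]
    | inv f _ hf =>
      intro w
      rw [← hf (f⁻¹ w), Equiv.Perm.inv_def, Equiv.apply_symm_apply]
  exact key g.1 g.2 w

/-- The action of the automaton group on the set of words of length `n`. -/
instance levelAction (A : Automaton S X) (hA : A.IsInvertible) (n : ℕ) :
    MulAction (A.group hA) (List.Vector X n) where
  smul g w := ⟨g.1 w.1, (A.length_group_apply hA g w.1).trans w.2⟩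
  one_smul _ := rfl
  mul_smul _ _ _ := rfl

end Automaton

/-- The Schreier graph of the action of `Γ` on `M` with respect to the elements of `T` and their
inverses, as an undirected, unlabeled graph without loops and multiple edges. -/
def schreierGraph {Γ M : Type*} [Group Γ] [MulAction Γ M] (T : Set Γ) : SimpleGraph M where
  Adj m m' := m ≠ m' ∧ ∃ t ∈ T ∪ T⁻¹, t • m = m'
  symm := ⟨by
    rintro m m' ⟨hne, t, ht, rfl⟩
    refine ⟨hne.symm, t⁻¹, ?_, inv_smul_smul t m⟩
    rcases ht with ht | ht
    · exact Or.inr (by simpa using ht)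
    · exact Or.inl ht⟩
  loopless := ⟨fun _ h => h.1 rfl⟩

/-- The `n`-th Schreier graph of an invertible automaton: the action of the automaton group on
the words of length `n`, with the states and their inverses as generators. -/
noncomputable def Automaton.levelGraph {S X : Type*} (A : Automaton S X) (hA : A.IsInvertible)
    (n : ℕ) : SimpleGraph (List.Vector X n) :=
  schreierGraph (Set.range (A.gen hA))

/-- An orientation of the edges of a simple graph: a choice of exactly one of the ordered pairs
`(x, y)`, `(y, x)` for each edge `{x, y}`. -/
structure EdgeOrientation {V : Type*} (G : SimpleGraph V) where
  /-- the set of oriented edges -/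
  edges : Set (V × V)
  adj_of_mem : ∀ e ∈ edges, G.Adj e.1 e.2
  exactly_one : ∀ x y, G.Adj x y → Xor ((x, y) ∈ edges) ((y, x) ∈ edges)

namespace EdgeOrientation

variable {V : Type*} [DecidableEq V] {G : SimpleGraph V}

/-- The automaton of an oriented graph. The states are the oriented edges and the sink `none`;
the state `e = (x, y)` restricts to itself at the letter `x` and to the sink at all other letters,
and its output exchanges `x` and `y`. -/
def automaton (O : EdgeOrientation G) : Automaton (Option O.edges) V where
  restr
    | none, _ => none
    | some e, z => if z = e.1.1 then some e else none
  out
    | none, z => z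
    | some e, z => Equiv.swap e.1.1 e.1.2 z

theorem automaton_isInvertible (O : EdgeOrientation G) : O.automaton.IsInvertible
  | none => Function.bijective_id
  | some e => (Equiv.swap e.1.1 e.1.2).bijective

/-- The `n`-th Schreier graph of the graph automaton group of an oriented graph. -/
noncomputable def schreier (O : EdgeOrientation G) (n : ℕ) : SimpleGraph (List.Vector V n) :=
  O.automaton.levelGraph O.automaton_isInvertible n

end EdgeOrientation

end GraphAutomaton

namespace GraphAutomaton

/-! ### The generators as carry maps -/

section Carry

variable {V : Type*} [DecidableEq V]

/-- The action on words of the oriented edge `(x, y)`. -/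
def carry (x y : V) : List V → List V
  | [] => []
  | z :: w => Equiv.swap x y z :: if z = x then carry x y w else w

theorem carry_carry {x y : V} (h : x ≠ y) (w : List V) : carry y x (carry x y w) = w := by
  induction w with
  | nil => rfl
  | cons z w ih =>
    by_cases hx : z = x
    · subst hx
      simp [carry, ih]
    · by_cases hy : z = y
      · subst hy
        simp [carry, h, hx]
      · simp [carry, hx, hy, Equiv.swap_apply_of_ne_of_ne]

theorem length_carry (x y : V) (w : List V) : (carry x y w).length = w.length := by
  induction w with
  | nil => rfl
  | cons z w ih =>
    by_cases hx : z = x <;> simp [carry, hx, ih]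

/-- The carry reaches the last letter only through a constant prefix; this drives both inductions on
the length. -/
theorem carry_append_singleton (x y : V) (w : List V) (z : V) :
    carry x y (w ++ [z]) =
      carry x y w ++ [if ∀ a ∈ w, a = x then Equiv.swap x y z else z] := by
  induction w with
  | nil => simp [carry]
  | cons a w ih =>
    by_cases ha : a = x <;> simp [carry, ha, ih]

theorem carry_replicate_append (x y : V) (n : ℕ) (s : List V) :
    carry x y (List.replicate n x ++ s) = List.replicate n y ++ carry x y s := by
  induction n with
  | zero => rfl
  | succ n ih => simp [List.replicate_succ, carry, ih]

theorem iterate_carry_cons {x y c : V} (h : x ≠ y) (hc : c = x ∨ c = y) (m : ℕ) (w : List V) :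
    (carry x y)^[2 * m] (c :: w) = c :: (carry x y)^[m] w := by
  induction m generalizing w with
  | zero => rfl
  | succ m ih =>
    have : carry x y (carry x y (c :: w)) = c :: carry x y w := by
      rcases hc with rfl | rfl
      · simp [carry, h.symm]
      · simp [carry, h.symm]
    rw [show 2 * (m + 1) = 2 * m + 1 + 1 by ring, Function.iterate_succ_apply,
      Function.iterate_succ_apply, this, ih, Function.iterate_succ_apply]

/-- One full turn of the odometer on `n` digits restores them and passes a single carry to the rest
of the word. -/
theorem iterate_carry_replicate {x y c : V} (h : x ≠ y) (hc : c = x ∨ c = y) (n : ℕ)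
    (w : List V) :
    (carry x y)^[2 ^ n] (List.replicate n c ++ w) = List.replicate n c ++ carry x y w := by
  induction n with
  | zero => rfl
  | succ n ih =>
    rw [List.replicate_succ, List.cons_append, pow_succ', iterate_carry_cons h hc, ih,
      List.cons_append]

end Carry

namespace EdgeOrientation

variable {V : Type*} [DecidableEq V] {G : SimpleGraph V}

theorem wordOut_none (O : EdgeOrientation G) (w : List V) : O.automaton.wordOut none w = w := by
  induction w with
  | nil => rfl
  | cons z w ih => exact congrArg (z :: ·) ih

theorem wordOut_some (O : EdgeOrientation G) (e : O.edges) (w : List V) :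
    O.automaton.wordOut (some e) w = carry e.1.1 e.1.2 w := by
  induction w with
  | nil => rfl
  | cons z w ih =>
    by_cases h : z = e.1.1
    · simp [Automaton.wordOut, automaton, carry, h, ← ih]
    · have := O.wordOut_none w
      simp only [automaton] at this
      simp [Automaton.wordOut, automaton, carry, h, this]

theorem coe_gen_smul (O : EdgeOrientation G) {n : ℕ} (s : Option O.edges) (u : List.Vector V n) :
    (O.automaton.gen O.automaton_isInvertible s • u).1 = O.automaton.wordOut s u.1 :=
  rfl

/-- The orientation becomes irrelevant, because reversing an edge inverts its generator. -/
theorem schreier_adj (O : EdgeOrientation G) {n : ℕ} {u v : List.Vector V n} :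
    (O.schreier n).Adj u v ↔ u ≠ v ∧ ∃ x y, G.Adj x y ∧ carry x y u.1 = v.1 := by
  refine and_congr_right fun hne => ⟨?_, ?_⟩
  · rintro ⟨t, ⟨s, rfl⟩ | ⟨s, hs⟩, rfl⟩
    · rcases s with _ | e
      · exact absurd (Subtype.ext (O.wordOut_none u.1).symm) hne
      · exact ⟨_, _, O.adj_of_mem _ e.2, (O.wordOut_some e u.1).symm⟩
    · have hu : O.automaton.gen O.automaton_isInvertible s • (t • u) = u := by
        rw [hs, inv_smul_smul]
      have hu' := (O.coe_gen_smul s (t • u)).symm.trans (congrArg Subtype.val hu)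
      rcases s with _ | e
      · rw [wordOut_none] at hu'
        exact absurd (Subtype.ext hu'.symm) hne
      · rw [wordOut_some] at hu'
        have hadj := O.adj_of_mem _ e.2
        exact ⟨_, _, hadj.symm, (congrArg _ hu'.symm).trans (carry_carry hadj.ne _)⟩
  · rintro ⟨x, y, hxy, h⟩
    by_cases hmem : (x, y) ∈ O.edges
    · refine ⟨_, Or.inl ⟨some ⟨_, hmem⟩, rfl⟩, Subtype.ext ?_⟩
      rw [coe_gen_smul, wordOut_some]
      exact h
    · have hmem' : (y, x) ∈ O.edges := by
        rcases O.exactly_one x y hxy with h | h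
        · exact absurd h.1 hmem
        · exact h.1
      refine ⟨(O.automaton.gen O.automaton_isInvertible (some ⟨_, hmem'⟩))⁻¹,
        Or.inr ⟨some ⟨_, hmem'⟩, (inv_inv _).symm⟩, ?_⟩
      rw [inv_smul_eq_iff]
      refine Subtype.ext ?_
      rw [coe_gen_smul, wordOut_some, ← h]
      exact (carry_carry hxy.ne u.1).symm

end EdgeOrientation

/-! ### Upper bound -/

section Near

variable {V : Type*} [DecidableEq V] {G : SimpleGraph V}

/-- `Near G m u v`: the word `v` is reached from `u` by at most `m` moves along edges of `G`. -/
inductive Near (G : SimpleGraph V) : ℕ → List V → List V → Prop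
  | refl (m : ℕ) (u : List V) : Near G m u u
  | head {m : ℕ} {x y : V} {u v : List V} (h : G.Adj x y) (huv : Near G m (carry x y u) v) :
      Near G (m + 1) u v

namespace Near

theorem mono {m m' : ℕ} {u v : List V} (h : Near G m u v) (hm : m ≤ m') : Near G m' u v := by
  induction h generalizing m' with
  | refl => exact refl _ _
  | head hxy _ ih =>
    obtain ⟨m', rfl⟩ : ∃ l, m' = l + 1 := ⟨m' - 1, by omega⟩
    exact head hxy (ih (by omega))

theorem trans {m m' : ℕ} {u v w : List V} (h : Near G m u v) (h' : Near G m' v w) :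
    Near G (m + m') u w := by
  induction h with
  | refl => exact h'.mono (by omega)
  | head hxy _ ih => exact (head hxy (ih h')).mono (by omega)

theorem single {x y : V} (h : G.Adj x y) (u : List V) : Near G 1 u (carry x y u) :=
  head h (refl 0 _)

theorem symm {m : ℕ} {u v : List V} (h : Near G m u v) : Near G m v u := by
  induction h with
  | refl => exact refl _ _
  | @head m x y u v hxy _ ih =>
    have := single hxy.symm (carry x y u)
    rw [carry_carry hxy.ne] at this
    exact ih.trans this

theorem iterate {x y : V} (h : G.Adj x y) (m : ℕ) (u : List V) :
    Near G m u ((carry x y)^[m] u) := by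
  induction m generalizing u with
  | zero => exact refl _ _
  | succ m ih => exact head h (ih _)

/-- Replaying the same moves on a longer word acts identically on the prefix; the extra letter is
dragged along to an uncontrolled value. -/
theorem exists_append_singleton {m : ℕ} {u v : List V} (h : Near G m u v) (z : V) :
    ∃ z', Near G m (u ++ [z]) (v ++ [z']) := by
  induction h generalizing z with
  | refl => exact ⟨z, refl _ _⟩
  | @head m x y u v hxy _ ih =>
    obtain ⟨z', hz⟩ := ih (if ∀ a ∈ u, a = x then Equiv.swap x y z else z)
    exact ⟨z', head hxy (by rwa [carry_append_singleton])⟩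

theorem replicate_append {a b : V} (h : G.Adj a b) (n : ℕ) {s : List V} (ha : a ∉ s) (hb : b ∉ s) :
    Near G 1 (List.replicate n a ++ s) (List.replicate n b ++ s) := by
  have hs : carry a b s = s := by
    cases s with
    | nil => rfl
    | cons z s =>
      simp only [List.mem_cons, not_or] at ha hb
      simp [carry, Ne.symm ha.1, Equiv.swap_apply_of_ne_of_ne (Ne.symm ha.1) (Ne.symm hb.1)]
  simpa only [carry_replicate_append, hs] using single h (List.replicate n a ++ s)

theorem replicate_succ {c z : V} (h : G.Adj c z) (n : ℕ) :
    Near G (2 ^ n) (List.replicate n c ++ [z]) (List.replicate (n + 1) c) := by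
  have := iterate h (2 ^ n) (List.replicate n c ++ [z])
  rw [iterate_carry_replicate h.ne (Or.inl rfl)] at this
  simpa [carry, List.replicate_succ'] using this

/-- A move in `Near` may fix the word, which is a loop absent from the simple graph; such a move
costs distance zero. -/
theorem edist_le (O : EdgeOrientation G) {m : ℕ} {l l' : List V} (h : Near G m l l') {n : ℕ} :
    ∀ u v : List.Vector V n, u.1 = l → v.1 = l' → (O.schreier n).edist u v ≤ m := by
  induction h with
  | refl m l =>
    intro u v hu hv
    rw [show u = v from Subtype.ext (hu.trans hv.symm), SimpleGraph.edist_self]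
    exact zero_le
  | @head m x y l l' hxy _ ih =>
    intro u v hu hv
    let u' : List.Vector V n := ⟨carry x y u.1, (length_carry x y u.1).trans u.2⟩
    have h' := ih u' v (by rw [← hu]) hv
    have h1 : (O.schreier n).edist u u' ≤ 1 := by
      by_cases hne : u = u'
      · rw [← hne, SimpleGraph.edist_self]
        exact zero_le
      · exact (SimpleGraph.edist_eq_one_iff_adj.2 (O.schreier_adj.2 ⟨hne, x, y, hxy, rfl⟩)).le
    calc (O.schreier n).edist u v
        ≤ (O.schreier n).edist u u' + (O.schreier n).edist u' v := SimpleGraph.edist_triangle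
      _ ≤ 1 + m := add_le_add h1 h'
      _ = ((m + 1 : ℕ) : ℕ∞) := by push_cast; rw [add_comm]

end Near

end Near

/-! ### Distances to constant words over the path -/

section PathGraph

variable {K : ℕ}

/-- The largest distance from a word of length `m + 1` over `K + 3` letters to the set of constant
words in an inner letter of the path. -/
def radius (K : ℕ) : ℕ → ℕ
  | 0 => 1
  | m + 1 => radius K m + (2 ^ (m + 1) + K)

/-- No letter of `s` lies between `a` and `b`, so the carry stops at `s` and the whole constant
block shifts by one letter per move. -/
theorem near_replicate (n d : ℕ) {a b : Fin (K + 3)} (hab : a.val + d = b.val)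
    {s : List (Fin (K + 3))} (hs : ∀ z ∈ s, z < a ∨ b < z) :
    Near (SimpleGraph.pathGraph (K + 3)) d (List.replicate n a ++ s)
      (List.replicate n b ++ s) := by
  induction d generalizing a with
  | zero =>
    obtain rfl : a = b := Fin.ext hab
    exact Near.refl _ _
  | succ d ih =>
    let c : Fin (K + 3) := ⟨a.val + 1, by omega⟩
    have hac : (SimpleGraph.pathGraph (K + 3)).Adj a c := by
      rw [SimpleGraph.pathGraph_adj]
      exact Or.inl rfl
    have h1 : Near (SimpleGraph.pathGraph (K + 3)) 1 (List.replicate n a ++ s)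
        (List.replicate n c ++ s) := by
      refine Near.replicate_append hac n (fun h => ?_) (fun h => ?_)
      · have := hs _ h
        simp only [Fin.lt_def] at this
        omega
      · have := hs _ h
        simp only [Fin.lt_def, c] at this
        omega
    have h2 := ih (a := c) (by simp only [c]; omega) (fun z hz => by
      have := hs z hz
      simp only [Fin.lt_def, c] at this ⊢
      omega)
    exact (h1.trans h2).mono (by omega)

theorem exists_near_replicate (m : ℕ) (u : List (Fin (K + 3))) (hu : u.length = m + 1) :
    ∃ j : Fin (K + 3), 1 ≤ j.val ∧ j.val ≤ K + 1 ∧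
      Near (SimpleGraph.pathGraph (K + 3)) (radius K m) u (List.replicate (m + 1) j) := by
  induction m generalizing u with
  | zero =>
    obtain ⟨z, rfl⟩ := List.length_eq_one_iff.1 hu
    by_cases h0 : z.val = 0
    · refine ⟨⟨1, by omega⟩, le_rfl, by simp, ?_⟩
      simpa [radius] using near_replicate 1 1 (a := z) (b := ⟨1, by omega⟩) (s := []) (by simp [h0])
        (by simp)
    by_cases h1 : z.val = K + 2
    · refine ⟨⟨K + 1, by omega⟩, by simp, le_rfl, ?_⟩
      simpa [radius] using (near_replicate 1 1 (b := z) (a := ⟨K + 1, by omega⟩) (s := []) (by simp [h1])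
        (by simp)).symm
    · exact ⟨z, by omega, by omega, Near.refl _ _⟩
  | succ m ih =>
    obtain ⟨w, z, rfl⟩ : ∃ w z, u = w ++ [z] :=
      ⟨_, _, (List.dropLast_append_getLast (List.ne_nil_of_length_eq_add_one hu)).symm⟩
    obtain ⟨j, hj1, hj2, hj⟩ := ih w (by simpa using hu)
    obtain ⟨z', hz⟩ := hj.exists_append_singleton z
    rcases lt_trichotomy z'.val j.val with hlt | heq | hgt
    -- The inner neighbour of `z'` on the side of `j`: shift the prefix to `c` in at most `K` moves,
    -- then one turn of the odometer turns `z'` into `c`.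
    · let c : Fin (K + 3) := ⟨z'.val + 1, by omega⟩
      have h1 := (near_replicate (m + 1) (j.val - c.val) (a := c) (b := j) (s := [z'])
        (by simp only [c]; omega) (fun y hy => Or.inl (by
          rw [List.mem_singleton.1 hy, Fin.lt_def]; exact Nat.lt_succ_self _))).symm
      have h2 := Near.replicate_succ (G := SimpleGraph.pathGraph (K + 3)) (c := c) (z := z')
        (by rw [SimpleGraph.pathGraph_adj]; exact Or.inr rfl) (m + 1)
      refine ⟨c, by simp [c], by simp only [c]; omega, ((hz.trans h1).trans h2).mono ?_⟩
      simp only [radius, c]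
      omega
    · obtain rfl : z' = j := Fin.ext heq
      refine ⟨z', hj1, hj2, ?_⟩
      rw [List.replicate_succ']
      exact hz.mono (by simp [radius])
    · let c : Fin (K + 3) := ⟨z'.val - 1, by omega⟩
      have h1 := near_replicate (m + 1) (c.val - j.val) (a := j) (b := c) (s := [z'])
        (by simp only [c]; omega) (fun y hy => Or.inr (by
          rw [List.mem_singleton.1 hy, Fin.lt_def]; simp only [c]; omega))
      have h2 := Near.replicate_succ (G := SimpleGraph.pathGraph (K + 3)) (c := c) (z := z')
        (by rw [SimpleGraph.pathGraph_adj]; simp only [c]; omega) (m + 1)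
      refine ⟨c, by simp only [c]; omega, by simp only [c]; omega,
        ((hz.trans h1).trans h2).mono ?_⟩
      simp only [radius, c]
      omega

theorem edist_schreier_le (O : EdgeOrientation (SimpleGraph.pathGraph (K + 3))) (m : ℕ)
    (u v : List.Vector (Fin (K + 3)) (m + 1)) :
    (O.schreier (m + 1)).edist u v ≤ (2 * radius K m + K : ℕ) := by
  obtain ⟨i, hi1, hi2, hi⟩ := exists_near_replicate m u.1 u.2
  obtain ⟨j, hj1, hj2, hj⟩ := exists_near_replicate m v.1 v.2
  have hij : Near (SimpleGraph.pathGraph (K + 3)) K (List.replicate (m + 1) i)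
      (List.replicate (m + 1) j) := by
    rcases le_total i.val j.val with h | h
    · simpa using (near_replicate (m + 1) (j.val - i.val) (a := i) (b := j) (s := []) (by omega)
        (by simp)).mono (show _ ≤ K by omega)
    · simpa using (near_replicate (m + 1) (i.val - j.val) (a := j) (b := i) (s := []) (by omega)
        (by simp)).symm.mono (show _ ≤ K by omega)
  exact Near.edist_le O (((hi.trans hij).trans hj.symm).mono (by omega)) u v rfl rfl

end PathGraph

/-! ### Lower bound -/

section RevCarry

variable {V W : Type*} [DecidableEq V] [DecidableEq W]

/-- The map `carry` on words written from the last letter to the first. -/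
def revCarry (x y : V) : List V → List V
  | [] => []
  | z :: w => (if ∀ a ∈ w, a = x then Equiv.swap x y z else z) :: revCarry x y w

/-- Reversal makes the last letter the head, so structural induction on lists follows the passage
from one level to the next. -/
theorem reverse_carry (x y : V) (w : List V) :
    (carry x y w).reverse = revCarry x y w.reverse := by
  induction w using List.reverseRecOn with
  | nil => rfl
  | append_singleton w z ih => simp [carry_append_singleton, revCarry, ih]

theorem map_revCarry {f : V → W} (hf : Function.Injective f) (x y : V) (w : List V) :
    (revCarry x y w).map f = revCarry (f x) (f y) (w.map f) := by
  induction w with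
  | nil => rfl
  | cons z w ih =>
    simp only [revCarry, List.map_cons, ih, List.forall_mem_map, hf.eq_iff]
    split_ifs
    · rw [hf.map_swap]
    · rfl

theorem length_revCarry (x y : V) (w : List V) : (revCarry x y w).length = w.length := by
  induction w with
  | nil => rfl
  | cons z w ih => simp [revCarry, ih]

theorem revCarry_replicate (x y : V) (n : ℕ) :
    revCarry x y (List.replicate n x) = List.replicate n y := by
  induction n with
  | zero => rfl
  | succ n ih =>
    rw [List.replicate_succ, revCarry, ih, if_pos fun a ha => List.eq_of_mem_replicate ha,
      Equiv.swap_apply_left, List.replicate_succ]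

end RevCarry

/-- For a word over `{a, b}`, written from the last letter to the first, its value as a binary
number with digits `a = 1` and `b = 0`; for a general word, the value of its projection to the
words over `{a, b}`. -/
def binaryValue (a b : ℕ) : List ℕ → ℤ
  | [] => 0
  | z :: w => if z = a then 2 ^ w.length + binaryValue a b w
      else if z = b then binaryValue a b w else 0

/-! ### The odometer coordinate on words -/

section BinaryValue

variable {a b : ℕ}

theorem binaryValue_nonneg (a b : ℕ) (w : List ℕ) : 0 ≤ binaryValue a b w := by
  induction w with
  | nil => exact le_rfl
  | cons z w ih =>
    simp only [binaryValue]
    split_ifs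
    · positivity
    · exact ih
    · exact le_rfl

theorem binaryValue_replicate_self (a b n : ℕ) :
    binaryValue a b (List.replicate n a) = 2 ^ n - 1 := by
  induction n with
  | zero => rfl
  | succ n ih =>
    simp only [List.replicate_succ, binaryValue, if_true, List.length_replicate, ih]
    ring

theorem binaryValue_replicate_of_ne {c : ℕ} (hc : c ≠ a) (n : ℕ) :
    binaryValue a b (List.replicate n c) = 0 := by
  induction n with
  | zero => rfl
  | succ n ih => simp [List.replicate_succ, binaryValue, hc, ih]

/-- Such a move can change the head only when the tail is constant in `x ≠ a`, and then the value is
zero before and after. -/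
theorem binaryValue_revCarry_of_ne {x y : ℕ} (hx : x ≠ a) (hy : y ≠ a) (w : List ℕ) :
    binaryValue a b (revCarry x y w) = binaryValue a b w := by
  induction w with
  | nil => rfl
  | cons z w ih =>
    by_cases h : ∀ c ∈ w, c = x
    · obtain ⟨n, rfl⟩ : ∃ n, w = List.replicate n x := ⟨_, List.eq_replicate_of_mem h⟩
      simp only [revCarry, if_pos h, revCarry_replicate]
      by_cases hzx : z = x
      · simp [hzx, binaryValue, hx, hy, binaryValue_replicate_of_ne]
      by_cases hzy : z = y
      · simp [hzy, binaryValue, hx, hy, binaryValue_replicate_of_ne]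
      · simp [binaryValue, hx, hy, binaryValue_replicate_of_ne,
          Equiv.swap_apply_of_ne_of_ne hzx hzy]
    · simp only [revCarry, if_neg h, binaryValue, length_revCarry, ih]

/-- The hypothesis excludes the overflow of the odometer from `2 ^ n - 1` to `0`. -/
theorem binaryValue_revCarry (hab : a ≠ b) {w : List ℕ} (hw : ¬∀ c ∈ w, c = a) :
    binaryValue a b (revCarry a b w) = binaryValue a b w ∨
      binaryValue a b (revCarry a b w) = binaryValue a b w + 1 := by
  induction w with
  | nil => simp at hw
  | cons z w ih =>
    by_cases h : ∀ c ∈ w, c = a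
    · have hz : z ≠ a := fun hz => hw (by simpa [hz] using h)
      obtain ⟨n, rfl⟩ : ∃ n, w = List.replicate n a := ⟨_, List.eq_replicate_of_mem h⟩
      simp only [revCarry, if_pos h, revCarry_replicate]
      by_cases hzb : z = b
      · right
        simp [hzb, binaryValue, hab.symm, binaryValue_replicate_of_ne,
          binaryValue_replicate_self]
      · left
        simp [binaryValue, hz, hzb, Equiv.swap_apply_of_ne_of_ne hz hzb]
    · have := ih h
      simp only [revCarry, if_neg h, binaryValue, length_revCarry]
      split_ifs <;> omega

/-- Among words of value zero, only the constant word in `b` lies on the cycle itself; the others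
hang off it and keep value zero. This locates the only crossing between the two branches of
`height`. -/
theorem eq_replicate_of_binaryValue_revCarry (hab : a ≠ b) {w : List ℕ}
    (h0 : binaryValue a b w = 0) (h1 : binaryValue a b (revCarry a b w) ≠ 0) :
    w = List.replicate w.length b := by
  induction w with
  | nil => rfl
  | cons z w ih =>
    have hpos : (0 : ℤ) < 2 ^ w.length := by positivity
    have hnn := binaryValue_nonneg a b w
    have hz : z ≠ a := by
      rintro rfl
      simp only [binaryValue, if_true] at h0
      omega
    by_cases hzb : z = b
    · subst hzb
      simp only [binaryValue, if_neg hz, if_true] at h0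
      by_cases h : ∀ c ∈ w, c = a
      · obtain ⟨n, rfl⟩ : ∃ n, w = List.replicate n a := ⟨_, List.eq_replicate_of_mem h⟩
        rw [binaryValue_replicate_self] at h0
        obtain rfl : n = 0 := by
          by_contra hn
          have : (1 : ℤ) < 2 ^ n := one_lt_pow₀ (by norm_num) hn
          omega
        rfl
      · simp only [revCarry, if_neg h, binaryValue, if_neg hz, if_true] at h1
        rw [List.length_cons, List.replicate_succ, ← ih h0 h1]
    · refine absurd ?_ h1
      simp only [revCarry]
      split_ifs <;> simp [binaryValue, hz, hzb, Equiv.swap_apply_of_ne_of_ne hz hzb]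

end BinaryValue

/-- A function on words over `{0, …, K + 2}`, written from the last letter to the first, which
changes by at most one under every generator. -/
def height (K : ℕ) : List ℕ → ℤ
  | [] => 0
  | z :: w =>
    if w = [] then z
    else if z = 0 then
      if binaryValue 0 1 w = 0 then 2 - 2 ^ w.length - height K w
      else 1 - 2 ^ w.length + binaryValue 0 1 w
    else if z = K + 2 then
      if binaryValue (K + 2) (K + 1) w = 0 then 2 * K + 2 + 2 ^ w.length - height K w
      else K + 1 + 2 ^ w.length - binaryValue (K + 2) (K + 1) w
    else z - (if z = 1 then binaryValue 0 1 w else 0) +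
      (if z = K + 1 then binaryValue (K + 2) (K + 1) w else 0)

/-! ### The height function is 1-Lipschitz -/

section Height

variable {K : ℕ}

theorem height_replicate (n : ℕ) {j : ℕ} (hj : j ≤ K + 2) :
    height K (List.replicate (n + 1) j) = j := by
  cases n with
  | zero => simp [height]
  | succ n =>
    have h2 : (1 : ℤ) < 2 ^ (n + 1) := one_lt_pow₀ (by norm_num) (by omega)
    rw [List.replicate_succ, height]
    simp only [List.length_replicate]
    by_cases h0 : j = 0
    · subst h0
      rw [binaryValue_replicate_self]
      simp
      omega
    by_cases hK : j = K + 2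
    · subst hK
      rw [binaryValue_replicate_self]
      simp
      omega
    · simp [h0, hK, binaryValue_replicate_of_ne]

theorem swap_cases (x y z : ℕ) :
    z = x ∧ Equiv.swap x y z = y ∨ z ≠ x ∧ z = y ∧ Equiv.swap x y z = x ∨
      z ≠ x ∧ z ≠ y ∧ Equiv.swap x y z = z := by
  by_cases hx : z = x
  · simp [hx]
  · by_cases hy : z = y
    · simp_all
    · simp [hx, hy, Equiv.swap_apply_of_ne_of_ne]

/-- If the tail is constant in `0`, the odometer overflows and copies `0` and `1` are exchanged,
where all heights are explicit. Otherwise the head is fixed, and the change comes from the odometer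
coordinate or from the height of the tail. -/
theorem abs_height_revCarry_le_zero_one {w : List ℕ} :
    |height K (revCarry 0 1 w) - height K w| ≤ 1 := by
  induction w with
  | nil => simp [revCarry]
  | cons z w ih =>
    rw [abs_le] at ih ⊢
    have hq : binaryValue (K + 2) (K + 1) (revCarry 0 1 w) = binaryValue (K + 2) (K + 1) w :=
      binaryValue_revCarry_of_ne (by omega) (by omega) w
    by_cases hw : w = []
    · subst hw
      have := swap_cases 0 1 z
      simp only [revCarry, height]
      simp
      omega
    have hw' : revCarry 0 1 w ≠ [] := fun h => hw (by
      rw [← List.length_eq_zero_iff, ← length_revCarry 0 1 w, h, List.length_nil])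
    by_cases h : ∀ c ∈ w, c = 0
    · obtain ⟨n, rfl⟩ : ∃ n, w = List.replicate (n + 1) 0 :=
        ⟨w.length - 1, by
          rw [Nat.sub_add_cancel (List.length_pos_iff.2 hw)]; exact List.eq_replicate_of_mem h⟩
      have hs := swap_cases 0 1 z
      have h2 : (1 : ℤ) < 2 ^ (n + 1) := one_lt_pow₀ (by norm_num) (by omega)
      have hf0 := height_replicate (K := K) n (j := 0) (by omega)
      have hf1 := height_replicate (K := K) n (j := 1) (by omega)
      have hp0 := binaryValue_replicate_self 0 1 (n + 1)
      have hp1 : binaryValue 0 1 (List.replicate (n + 1) 1) = 0 :=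
        binaryValue_replicate_of_ne (by omega) _
      have hq0 : binaryValue (K + 2) (K + 1) (List.replicate (n + 1) 0) = 0 :=
        binaryValue_replicate_of_ne (by omega) _
      rw [revCarry_replicate] at hq hw'
      simp only [revCarry, if_pos h, revCarry_replicate, height, if_neg hw, if_neg hw',
        List.length_replicate, hf0, hf1, hp0, hp1, hq0, hq]
      generalize Equiv.swap 0 1 z = z' at *
      clear * - hs h2
      generalize (2 : ℤ) ^ (n + 1) = N at *
      split_ifs <;> omega
    · have hp := binaryValue_revCarry (zero_ne_one (α := ℕ)) h
      have hnn := binaryValue_nonneg 0 1 w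
      -- Crossing from the reflected branch to the climbing one happens only at the constant tail
      -- `1`, of height `1`, where both formulas give `1 - 2 ^ w.length`.
      have hf : binaryValue 0 1 w = 0 → binaryValue 0 1 (revCarry 0 1 w) ≠ 0 →
          height K w = 1 := fun h0 h1 => by
        rw [eq_replicate_of_binaryValue_revCarry (by omega) h0 h1,
          ← Nat.sub_add_cancel (List.length_pos_iff.2 hw)]
        exact height_replicate _ (by omega)
      simp only [revCarry, if_neg h, height, if_neg hw, if_neg hw', length_revCarry, hq]
      split_ifs <;> omega

/-- Mirror image of the edge `{0, 1}` under `j ↦ K + 2 - j`, which also sends the height `h` to `K +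
2 - h`. -/
theorem abs_height_revCarry_le_last {w : List ℕ} :
    |height K (revCarry (K + 2) (K + 1) w) - height K w| ≤ 1 := by
  induction w with
  | nil => simp [revCarry]
  | cons z w ih =>
    rw [abs_le] at ih ⊢
    have hq : binaryValue 0 1 (revCarry (K + 2) (K + 1) w) = binaryValue 0 1 w :=
      binaryValue_revCarry_of_ne (by omega) (by omega) w
    by_cases hw : w = []
    · subst hw
      have := swap_cases (K + 2) (K + 1) z
      simp only [revCarry, height]
      simp
      omega
    have hw' : revCarry (K + 2) (K + 1) w ≠ [] := fun h => hw (by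
      rw [← List.length_eq_zero_iff, ← length_revCarry (K + 2) (K + 1) w, h, List.length_nil])
    by_cases h : ∀ c ∈ w, c = K + 2
    · obtain ⟨n, rfl⟩ : ∃ n, w = List.replicate (n + 1) (K + 2) :=
        ⟨w.length - 1, by
          rw [Nat.sub_add_cancel (List.length_pos_iff.2 hw)]; exact List.eq_replicate_of_mem h⟩
      have hs := swap_cases (K + 2) (K + 1) z
      have h2 : (1 : ℤ) < 2 ^ (n + 1) := one_lt_pow₀ (by norm_num) (by omega)
      have hf0 := height_replicate (K := K) n (j := K + 2) (by omega)
      have hf1 := height_replicate (K := K) n (j := K + 1) (by omega)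
      have hp0 := binaryValue_replicate_self (K + 2) (K + 1) (n + 1)
      have hp1 : binaryValue (K + 2) (K + 1) (List.replicate (n + 1) (K + 1)) = 0 :=
        binaryValue_replicate_of_ne (by omega) _
      have hq0 : binaryValue 0 1 (List.replicate (n + 1) (K + 2)) = 0 :=
        binaryValue_replicate_of_ne (by omega) _
      rw [revCarry_replicate] at hq hw'
      simp only [revCarry, if_pos h, revCarry_replicate, height, if_neg hw, if_neg hw',
        List.length_replicate, hf0, hf1, hp0, hp1, hq0, hq]
      generalize Equiv.swap (K + 2) (K + 1) z = z' at *
      clear * - hs h2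
      generalize (2 : ℤ) ^ (n + 1) = N at *
      split_ifs <;> omega
    · have hp := binaryValue_revCarry (by omega : K + 2 ≠ K + 1) h
      have hnn := binaryValue_nonneg (K + 2) (K + 1) w
      have hf : binaryValue (K + 2) (K + 1) w = 0 →
          binaryValue (K + 2) (K + 1) (revCarry (K + 2) (K + 1) w) ≠ 0 →
          height K w = (K + 1 : ℕ) := fun h0 h1 => by
        rw [eq_replicate_of_binaryValue_revCarry (by omega) h0 h1,
          ← Nat.sub_add_cancel (List.length_pos_iff.2 hw)]
        exact height_replicate _ (by omega)
      simp only [revCarry, if_neg h, height, if_neg hw, if_neg hw', length_revCarry, hq]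
      split_ifs <;> omega

/-- Inner edges preserve both odometer coordinates. If the head can move, the tail is constant in an
inner letter and both coordinates vanish, so the height of the word is just its head, unless the
head is an end letter. -/
theorem abs_height_revCarry_le_inner {i : ℕ} (hi : 1 ≤ i) (hiK : i ≤ K) {w : List ℕ} :
    |height K (revCarry i (i + 1) w) - height K w| ≤ 1 := by
  induction w with
  | nil => simp [revCarry]
  | cons z w ih =>
    rw [abs_le] at ih ⊢
    have hp : binaryValue 0 1 (revCarry i (i + 1) w) = binaryValue 0 1 w :=
      binaryValue_revCarry_of_ne (by omega) (by omega) w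
    have hq : binaryValue (K + 2) (K + 1) (revCarry i (i + 1) w) =
        binaryValue (K + 2) (K + 1) w :=
      binaryValue_revCarry_of_ne (by omega) (by omega) w
    have hs := swap_cases i (i + 1) z
    by_cases hw : w = []
    · subst hw
      simp only [revCarry, height]
      simp
      omega
    have hw' : revCarry i (i + 1) w ≠ [] := fun h => hw (by
      rw [← List.length_eq_zero_iff, ← length_revCarry i (i + 1) w, h, List.length_nil])
    simp only [revCarry, height, if_neg hw, if_neg hw', length_revCarry, hp, hq]
    by_cases h : ∀ c ∈ w, c = i
    · have hp0 : binaryValue 0 1 w = 0 := by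
        rw [List.eq_replicate_of_mem h]
        exact binaryValue_replicate_of_ne (by omega) _
      have hq0 : binaryValue (K + 2) (K + 1) w = 0 := by
        rw [List.eq_replicate_of_mem h]
        exact binaryValue_replicate_of_ne (by omega) _
      simp only [if_pos h, hp0, hq0]
      generalize Equiv.swap i (i + 1) z = z' at *
      split_ifs <;> omega
    · simp only [if_neg h]
      split_ifs <;> omega

/-- The height of a word over the vertices of the path graph. -/
def wordHeight (w : List (Fin (K + 3))) : ℤ :=
  height K (w.reverse.map Fin.val)

theorem abs_wordHeight_carry_le {x y : Fin (K + 3)}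
    (h : (SimpleGraph.pathGraph (K + 3)).Adj x y) (w : List (Fin (K + 3))) :
    |wordHeight (carry x y w) - wordHeight w| ≤ 1 := by
  have key : ∀ w, wordHeight (carry x y w) =
      height K (revCarry x.val y.val (w.reverse.map Fin.val)) := fun w => by
    rw [wordHeight, reverse_carry, map_revCarry Fin.val_injective]
  have key' : ∀ w, wordHeight (carry y x w) =
      height K (revCarry y.val x.val (w.reverse.map Fin.val)) := fun w => by
    rw [wordHeight, reverse_carry, map_revCarry Fin.val_injective]
  -- The Lipschitz bound for a generator is equivalent to that for its inverse, so one direction per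
  -- edge suffices.
  have hsymm : (∀ w : List (Fin (K + 3)), |wordHeight (carry y x w) - wordHeight w| ≤ 1) →
      |wordHeight (carry x y w) - wordHeight w| ≤ 1 := fun H => by
    have := H (carry x y w)
    rwa [carry_carry h.ne, abs_sub_comm] at this
  have hx := x.isLt
  have hy := y.isLt
  rw [SimpleGraph.pathGraph_adj] at h
  rcases h with h | h
  · by_cases h0 : x.val = 0
    · rw [key, show x.val = 0 from h0, show y.val = 1 by omega]
      exact abs_height_revCarry_le_zero_one
    by_cases hK : y.val = K + 2
    · refine hsymm fun w => ?_
      rw [key', hK, show x.val = K + 1 by omega]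
      exact abs_height_revCarry_le_last
    · rw [key, ← h]
      exact abs_height_revCarry_le_inner (by omega) (by omega)
  · by_cases h0 : y.val = 0
    · refine hsymm fun w => ?_
      rw [key', show y.val = 0 from h0, show x.val = 1 by omega]
      exact abs_height_revCarry_le_zero_one
    by_cases hK : x.val = K + 2
    · rw [key, hK, show y.val = K + 1 by omega]
      exact abs_height_revCarry_le_last
    · refine hsymm fun w => ?_
      rw [key', ← h]
      exact abs_height_revCarry_le_inner (by omega) (by omega)

theorem abs_wordHeight_sub_le_length (O : EdgeOrientation (SimpleGraph.pathGraph (K + 3))) {n : ℕ}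
    {u v : List.Vector (Fin (K + 3)) n} (p : (O.schreier n).Walk u v) :
    |wordHeight v.1 - wordHeight u.1| ≤ p.length := by
  induction p with
  | nil => simp
  | @cons u v w h p ih =>
    obtain ⟨-, x, y, hxy, he⟩ := O.schreier_adj.1 h
    have h1 := abs_wordHeight_carry_le hxy u.1
    rw [he] at h1
    rw [SimpleGraph.Walk.length_cons, Nat.cast_add, Nat.cast_one]
    rw [abs_le] at *
    omega

/-- The word of length `m + 1` with first letter `a` whose letters alternate between `a` and
`b`. -/
def alternating {V : Type*} (a b : V) : ℕ → List V
  | 0 => [a]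
  | m + 1 => a :: alternating b a m

theorem length_alternating {V : Type*} (a b : V) (m : ℕ) :
    (alternating a b m).length = m + 1 := by
  induction m generalizing a b with
  | zero => rfl
  | succ m ih => simp [alternating, ih]

theorem map_alternating {V W : Type*} (f : V → W) (a b : V) (m : ℕ) :
    (alternating a b m).map f = alternating (f a) (f b) m := by
  induction m generalizing a b with
  | zero => rfl
  | succ m ih => simp [alternating, ih]

theorem binaryValue_alternating {a b c d : ℕ} (h1 : c ≠ a) (h2 : c ≠ b) (m : ℕ) :
    binaryValue a b (alternating c d m) = 0 := by
  cases m <;> simp [alternating, binaryValue, h1, h2]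

/-- The tail begins with the opposite end letter, so its odometer coordinate vanishes and the
reflected branch applies; each further letter adds `2 ^ (m + 1) + K` to the deviation, as in
`radius`. -/
theorem height_alternating (m : ℕ) :
    height K (alternating 0 (K + 2) m) = 1 - (radius K m : ℤ) ∧
      height K (alternating (K + 2) 0 m) = K + 1 + (radius K m : ℤ) := by
  induction m with
  | zero =>
    simp [alternating, height, radius]
    ring
  | succ m ih =>
    have hne : ∀ c d : ℕ, alternating c d m ≠ [] := fun c d =>
      List.ne_nil_of_length_eq_add_one (length_alternating c d m)
    constructor
    · simp only [alternating, height, if_neg (hne _ _), if_true, length_alternating, ih,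
        binaryValue_alternating (show K + 2 ≠ 0 by omega) (show K + 2 ≠ 1 by omega), radius]
      push_cast
      ring
    · simp only [alternating, height, if_neg (hne _ _), if_true, length_alternating, ih,
        binaryValue_alternating (show 0 ≠ K + 2 by omega) (show 0 ≠ K + 1 by omega), radius,
        if_neg (show K + 2 ≠ 0 by omega)]
      push_cast
      ring

end Height

/-! ### The diameter -/

theorem ediam_schreier_pathGraph {K : ℕ} (O : EdgeOrientation (SimpleGraph.pathGraph (K + 3)))
    (m : ℕ) : (O.schreier (m + 1)).ediam = (2 * radius K m + K : ℕ) := by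
  refine le_antisymm (SimpleGraph.ediam_le_of_edist_le (edist_schreier_le O m)) ?_
  let a : Fin (K + 3) := 0
  let b : Fin (K + 3) := Fin.last (K + 2)
  let word (c d : Fin (K + 3)) : List.Vector (Fin (K + 3)) (m + 1) :=
    ⟨(alternating c d m).reverse, by rw [List.length_reverse, length_alternating]⟩
  have hword (c d : Fin (K + 3)) :
      wordHeight (word c d).1 = height K (alternating c.val d.val m) := by
    simp [wordHeight, word, map_alternating]
  -- The extended distance is an infimum over walks, so bounding every walk below needs no
  -- connectedness.
  refine le_trans (le_iInf fun p => ?_)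
    (SimpleGraph.edist_le_ediam (u := word a b) (v := word b a))
  have h := (le_abs_self _).trans (abs_wordHeight_sub_le_length O p)
  rw [hword, hword] at h
  have h' := height_alternating (K := K) m
  simp only [a, b, Fin.val_zero, Fin.val_last, h'.1, h'.2] at h
  exact_mod_cast (by omega : 2 * radius K m + K ≤ p.length)

theorem radius_eq (K m : ℕ) : (radius K m : ℤ) = 2 ^ (m + 1) - 1 + m * K := by
  induction m with
  | zero => simp [radius]
  | succ m ih =>
    simp only [radius]
    push_cast
    rw [ih]
    ring

end GraphAutomaton

theorem theorem4p10 (k : ℕ) (hk : 3 ≤ k)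
    (O : GraphAutomaton.EdgeOrientation (SimpleGraph.pathGraph k)) (n : ℕ) (hn : 1 ≤ n) :
    ((O.schreier n).diam : ℤ) = 2 ^ (n + 1) + ((k : ℤ) - 1) * (2 * (n : ℤ) - 1) - 4 * (n : ℤ) := by
  obtain ⟨K, rfl⟩ : ∃ K, k = K + 3 := ⟨k - 3, by omega⟩
  obtain ⟨m, rfl⟩ : ∃ m, n = m + 1 := ⟨n - 1, by omega⟩
  -- `diam` would be zero for an infinite extended diameter; here the latter is a natural number.
  rw [SimpleGraph.diam, GraphAutomaton.ediam_schreier_pathGraph, ENat.toNat_natCast]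
  push_cast
  rw [GraphAutomaton.radius_eq]
  ring
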